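/- **Setting.** A network $\mathcal N=(\mathcal V,\mathcal E,C)$ is a finite directed multigraph with link capacities $C_e>0$, a unique node $0$ without incoming links (the origin) and a unique node $n\neq 0$ without outgoing links (the destination), every other node lying on a directed path from $0$ to $n$. Write $\sigma_e,\tau_e$ for the tail and head of a link $e$, and $\mathcal E_v^+,\mathcal E_v^-$ for the sets of outgoing and incoming links of $v$. A constant inflow $\lambda>0$ enters at the origin; put $\lambda_0:=\lambda$ and $\lambda_v:=0$ for $v\ne 0$. *Routing.* A distributed routing policy is a family of functions $G^v(\mathcal J,\cdot):\mathbb R_+\to\mathbb R_+^{\mathcal J}$, $v\ne n$, $\emptyset\ne\mathcal J\subseteq\mathcal E_v^+$, with $\sum_{e\in\mathcal J}G^v_e(\mathcal J,\mu)=\mu$ and $G^v_e(\mathcal J,\mu)\le G^v_e(\mathcal K,\mu)$ for all $\mu\ge0$, $\emptyset\neq\mathcal K\subseteq\mathcal J$, $e\in\mathcal K$; put $G^v_e(\mathcal J,\mu):=0$ for $e\notin\mathcal J$. It is flow-monotone if for all $v\notin\{0,n\}$, all $\mathcal J$ and all $0\le\mu_1\le\mu_2$ one has $G^v_e(\mathcal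 J,\mu_1)\le G^v_e(\mathcal J,\mu_2)$ for $e\in\mathcal J$. *Dynamics.* The state at time $t=0,1,\dots$ consists of active non-destination nodes $\mathcal V(t)$, active links $\mathcal E(t)$, flows $f(t)$ and residual capacities $C(t)$. Initially $\mathcal V(0)=\mathcal V\setminus\{n\}$, $\mathcal E(0)=\mathcal E$, $C(0)=C$, and $f(0)\ge0$ is the flow prescribed by the policy: $f_e(0)=G^v_e(\mathcal E_v^+,\lambda_v+\sum_{j\in\mathcal E_v^-}f_j(0))$ for $e\in\mathcal E_v^+$, $v\ne n$. With $\mathcal E_v^\pm(t):=\mathcal E_v^\pm\cap\mathcal E(t)$ and $\lambda_v(t):=\lambda_v+\sum_{e\in\mathcal E_v^-(t)}f_e(t)$, $$\mathcal E(t+1)=\{e\in\mathcal E(t): f_e(t)<C_e(t)\text{ and }\tau_e\in\mathcal V(t)\cup\{n\}\},\qquad \mathcal V(t+1)=\{v\in\mathcal V(t):\mathcal E_v^+(t)\neq\emptyset\},$$ $$f_e(t+1)=G^v_e(\mathcal E_v^+(t),\lambda_v(t))\ \text{ for } v\in\mathcal V(t),\ e\in\mathcal E_v^+(t),\qquad f_e(t+1)=0\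 \text{ for all other links},$$ and $C(t+1)=C(t)-\delta(t+1)$. A disturbance process is a sequence $\delta(1),\delta(2),\dots\in\mathbb R_+^{\mathcal E}$ with $\sum_{s\le t}\delta(s)\le C$ for all $t$; its magnitude is $\mathcal D(\delta):=\sum_{e}\sum_{t\ge1}\delta_e(t)$. The dynamics is transferring if $\lim_{t\to\infty}\sum_{e\in\mathcal E_n^-}f_e(t)=\lambda$. *Backward Propagation Algorithm (BPA).* Suppose that the network has no directed cycle. For $v\ne n$, $\mathcal J\subseteq\mathcal E_v^+$, $r\in\mathbb R_+^{\mathcal E_v^+}$ and $\mu\ge0$ let $\mathcal X_v(\mathcal J,r,\mu)$ be the set of $x\in\mathbb R_+^{\mathcal J}$ with $r_e\le x_e\le C_e$ for $e\in\mathcal J$ and $\sum_{e\in\mathcal J}x_e=\mu$. Going backward from the destination, define $S(\mathcal J,r,\mu):=0$ if $\mathcal J=\emptyset$ or $\mathcal X_v(\mathcal J,r,\mu)=\emptyset$, and otherwise $$S(\mathcal J,r,\mu):=\max_{x\in\mathcal X_v(\mathcal J,r,\mu)}\ \min_{e\in\mathcal J}\Big(S_e(x_e)+S(\mathcal J\setminus\{e\},x,\mu)\Big),$$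 where $S_e(x):=C_e-x$ if $\tau_e=n$ and $S_e(x):=\min\{C_e-x,\,S(\mathcal E_{\tau_e}^+,\mathbf 0,x)\}$ otherwise. Let $g(\mathcal J,r,\mu)$ be the set of maximizers, and $S^*(\mathcal N,\lambda):=S(\mathcal E_0^+,\mathbf 0,\lambda)$. BPA routing is a distributed routing policy such that, for every $v\neq n$ and $\mu\ge0$, with $r^*:=G^v(\mathcal E_v^+,\mu)$: $r^*\in g(\mathcal E_v^+,\mathbf 0,\mu)$ if $\mathcal X_v(\mathcal E_v^+,\mathbf 0,\mu)\ne\emptyset$, and $G^v(\mathcal J,\mu)\in g(\mathcal J,r^*,\mu)$ for every nonempty $\mathcal J\subsetneq\mathcal E_v^+$ with $\mathcal X_v(\mathcal J,r^*,\mu)\neq\emptyset$. **Theorem.** Let $\mathcal N$ be a network with $|\mathcal E_v^+|\le3$ for all $v\neq n$, such that $(\mathcal V\setminus\{n\},\mathcal E\setminus\mathcal E_n^-)$ is a directed tree (the underlying undirected multigraph is a tree). Let $\lambda>0$ be the constant inflow at the origin, and let the routing policy be a BPA routing that is flow-monotone. Then the dynamics is transferring under every disturbance process $\delta$ with $\mathcal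 D(\delta)<S^*(\mathcal N,\lambda)$. -/

import Mathlib

open Filter Topology

noncomputable section

namespace CascadingFailure

/-- A single-commodity flow network: a finite directed multigraph with node set `V` and link set
`E` (parallel links are allowed), strictly positive link capacities, a unique node `origin` without
incoming links and a unique node `dest` without outgoing links.  Every other node lies on a
directed path from `origin` to `dest`. -/
structure Network (V E : Type*) where
  tail : E → V
  head : E → V
  cap : E → ℝ
  cap_pos : ∀ e, 0 < cap e
  origin : V
  dest : V
  origin_ne_dest : origin ≠ dest
  origin_iff : ∀ v, (∀ e, head e ≠ v) ↔ v = origin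
  dest_iff : ∀ v, (∀ e, tail e ≠ v) ↔ v = dest
  on_path : ∀ v, v ≠ origin → v ≠ dest →
    Relation.ReflTransGen (fun u w => ∃ e, tail e = u ∧ head e = w) origin v ∧
    Relation.ReflTransGen (fun u w => ∃ e, tail e = u ∧ head e = w) v dest

namespace Network

variable {V E : Type*} (N : Network V E)

/-- There is a link from `u` to `w`. -/
def Step (u w : V) : Prop := ∃ e, N.tail e = u ∧ N.head e = w

/-- The network contains no directed cycle. -/
def Acyclic : Prop := ∀ v, ¬ Relation.TransGen N.Step v v

/-- The simple undirected graph underlying the network without the destination node (and hence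
without the links into it). -/
def coreGraph : SimpleGraph {v : V // v ≠ N.dest} :=
  SimpleGraph.fromRel (fun u w => N.Step u w)

/-- The network without its destination node and without the links into the destination is a
directed tree: the undirected multigraph underlying it has no loops, no two links between the
same pair of nodes, and is a tree. -/
structure IsTree : Prop where
  no_loop : ∀ e, N.head e ≠ N.dest → N.tail e ≠ N.head e
  no_parallel : ∀ e e', N.head e ≠ N.dest → N.head e' ≠ N.dest →
    s(N.tail e, N.head e) = s(N.tail e', N.head e') → e = e'
  isTree : N.coreGraph.IsTree

variable {N}

theorem tail_ne_dest (e : E) : N.tail e ≠ N.dest :=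
  (N.dest_iff N.dest).2 rfl e

theorem Acyclic.wf [Finite V] (h : N.Acyclic) : WellFounded (fun w v => N.Step v w) := by
  have : IsTrans V (fun w v => Relation.TransGen N.Step v w) :=
    ⟨fun _ _ _ hab hbc => hbc.trans hab⟩
  have : Std.Irrefl (fun w v => Relation.TransGen N.Step v w) := ⟨h⟩
  exact Subrelation.wf (fun hs => Relation.TransGen.single hs)
    (Finite.wellFounded_of_trans_of_irrefl (fun w v => Relation.TransGen N.Step v w))

/-- A directed tree has no directed cycle. -/
theorem IsTree.acyclic (h : N.IsTree) : N.Acyclic := by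
  intro v hv
  obtain ⟨w, ⟨e, rfl, rfl⟩, hw⟩ := Relation.TransGen.head'_iff.1 hv
  have hd : N.head e ≠ N.dest := by
    intro hd
    rw [hd] at hw
    rcases Relation.ReflTransGen.cases_head hw with h1 | ⟨c, ⟨e', h1, -⟩, -⟩
    · exact tail_ne_dest e h1.symm
    · exact tail_ne_dest e' h1
  have hadj : N.coreGraph.Adj ⟨N.tail e, tail_ne_dest e⟩ ⟨N.head e, hd⟩ := by
    rw [coreGraph, SimpleGraph.fromRel_adj]
    exact ⟨fun hh => h.no_loop e hd (congrArg Subtype.val hh), Or.inl ⟨e, rfl, rfl⟩⟩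
  have hb := SimpleGraph.isAcyclic_iff_forall_adj_isBridge.1 h.isTree.isAcyclic hadj
  rw [SimpleGraph.isBridge_iff] at hb
  have key : ∀ u, Relation.ReflTransGen N.Step u (N.tail e) → ∀ hu : u ≠ N.dest,
      (N.coreGraph.deleteEdges {s(⟨N.tail e, tail_ne_dest e⟩, ⟨N.head e, hd⟩)}).Reachable
        ⟨u, hu⟩ ⟨N.tail e, tail_ne_dest e⟩ := by
    intro u hu
    induction hu using Relation.ReflTransGen.head_induction_on with
    | refl => intro _; exact SimpleGraph.Reachable.refl _
    | head h1 h2 ih =>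
      rename_i a c
      intro ha
      obtain ⟨e', rfl, rfl⟩ := h1
      have hc : N.head e' ≠ N.dest := by
        intro hc
        rw [hc] at h2
        rcases Relation.ReflTransGen.cases_head h2 with h3 | ⟨_, ⟨e'', h3, -⟩, -⟩
        · exact tail_ne_dest e h3.symm
        · exact tail_ne_dest e'' h3
      by_cases hee : e' = e
      · subst hee; exact SimpleGraph.Reachable.refl _
      · refine SimpleGraph.Reachable.trans (SimpleGraph.Adj.reachable ?_) (ih hc)
        rw [SimpleGraph.deleteEdges_adj]
        refine ⟨?_, ?_⟩
        · rw [coreGraph, SimpleGraph.fromRel_adj]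
          exact ⟨fun hh => h.no_loop e' hc (congrArg Subtype.val hh), Or.inl ⟨e', rfl, rfl⟩⟩
        · intro hs
          have hs' := congrArg (Sym2.map Subtype.val) (Set.mem_singleton_iff.1 hs)
          simp only [Sym2.map_mk] at hs'
          exact hee (h.no_parallel e' e hc hd hs')
  exact hb (key _ hw hd).symm

variable (N) [Fintype V] [Fintype E] [DecidableEq V] [DecidableEq E]

/-- The links going out of `v`. -/
def outLinks (v : V) : Finset E := Finset.univ.filter (fun e => N.tail e = v)

/-- The links coming into `v`. -/
def inLinks (v : V) : Finset E := Finset.univ.filter (fun e => N.head e = v)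

/-- The external inflow: `lam` at the origin and zero at every other node. -/
def extInflow (lam : ℝ) (v : V) : ℝ := if v = N.origin then lam else 0

/-! ### Routing policies -/

/-- A distributed oblivious routing policy.  `split v J μ e` is the flow that node `v` sends on
link `e` when its active outgoing links are `J` and its inflow is `μ`. -/
structure RoutingPolicy where
  split : V → Finset E → ℝ → E → ℝ
  nonneg : ∀ v, v ≠ N.dest → ∀ J ⊆ N.outLinks v, J.Nonempty → ∀ μ, 0 ≤ μ → ∀ e,
    0 ≤ split v J μ e
  support : ∀ v, v ≠ N.dest → ∀ J ⊆ N.outLinks v, J.Nonempty → ∀ μ, 0 ≤ μ → ∀ e, e ∉ J →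
    split v J μ e = 0
  sum_eq : ∀ v, v ≠ N.dest → ∀ J ⊆ N.outLinks v, J.Nonempty → ∀ μ, 0 ≤ μ →
    ∑ e ∈ J, split v J μ e = μ
  /-- link monotonicity -/
  link_mono : ∀ v, v ≠ N.dest → ∀ J ⊆ N.outLinks v, ∀ K ⊆ J, K.Nonempty → ∀ μ, 0 ≤ μ →
    ∀ e ∈ K, split v J μ e ≤ split v K μ e

variable {N} in
/-- The policy is flow-monotone at `v`. -/
def RoutingPolicy.FlowMonotoneAt (G : N.RoutingPolicy) (v : V) : Prop :=
  ∀ J ⊆ N.outLinks v, J.Nonempty → ∀ μ₁ μ₂, 0 ≤ μ₁ → μ₁ ≤ μ₂ →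
    ∀ e ∈ J, G.split v J μ₁ e ≤ G.split v J μ₂ e

variable {N} in
/-- The policy is flow-monotone over the network, i.e. at every node other than the origin and
the destination. -/
def RoutingPolicy.FlowMonotone (G : N.RoutingPolicy) : Prop :=
  ∀ v, v ≠ N.origin → v ≠ N.dest → G.FlowMonotoneAt v

/-! ### The Backward Propagation Algorithm -/

/-- The nonnegative vectors on `J` (extended by zero outside `J`) that lie between `r` and the
capacities on `J` and have total `μ`. -/
def feasible (J : Finset E) (r : E → ℝ) (μ : ℝ) : Set (E → ℝ) :=
  {x | (∀ e ∈ J, 0 ≤ x e ∧ r e ≤ x e ∧ x e ≤ N.cap e) ∧ (∀ e, e ∉ J → x e = 0) ∧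
    ∑ e ∈ J, x e = μ}

open Classical in
/-- The recursion over sets of links going out of one node, for given functions
`link e` on the individual links: the value is `0` if `J` is empty or no vector is feasible, and
otherwise the maximum over the feasible `x` of
`min_{e ∈ J} (link e (x e) + setMargin (J \ {e}) x μ)`. -/
def setMargin (link : E → ℝ → ℝ) (J : Finset E) (r : E → ℝ) (μ : ℝ) : ℝ :=
  if hJ : J.Nonempty then
    if (N.feasible J r μ).Nonempty then
      sSup ((fun x => J.attach.inf' hJ.attach
        (fun e => link e.1 (x e.1) + setMargin link (J.erase e.1) x μ)) '' N.feasible J r μ)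
    else 0
  else 0
termination_by J.card
decreasing_by exact Finset.card_erase_lt_of_mem e.2

variable {N} in
/-- `nodeMargin v μ` is the value that the algorithm computes at the node `v ≠ dest` for the set of
all links going out of `v`, zero lower bound and inflow `μ`; it is computed from the values at the
heads of these links.  The destination has value `+∞`, so that for a link `e` into the destination
`min {C_e - x, +∞} = C_e - x`. -/
def nodeMargin (h : N.Acyclic) : V → ℝ → ℝ :=
  h.wf.fix (fun v ih μ => N.setMargin
    (fun e x => if he : N.tail e = v ∧ N.head e ≠ N.dest then
        min (N.cap e - x) (ih (N.head e) ⟨e, he.1, rfl⟩ x)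
      else N.cap e - x)
    (N.outLinks v) 0 μ)

variable {N} in
/-- `S_e(μ) = min {C_e - μ, S(E⁺_{head e}, 0, μ)}`, where the second term is `+∞` if `e` leads into
the destination. -/
def linkMargin (h : N.Acyclic) (e : E) (μ : ℝ) : ℝ :=
  if N.head e = N.dest then N.cap e - μ else min (N.cap e - μ) (nodeMargin h (N.head e) μ)

variable {N} in
/-- `S(J, r, μ)`. -/
def margin (h : N.Acyclic) (J : Finset E) (r : E → ℝ) (μ : ℝ) : ℝ :=
  N.setMargin (linkMargin h) J r μ

variable {N} in
/-- `S*(N, lam) = S(E⁺_origin, 0, lam)`. -/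
def upperMargin (h : N.Acyclic) (lam : ℝ) : ℝ := margin h (N.outLinks N.origin) 0 lam

variable {N} in
/-- The recursive step at a set of links, as the algorithm states it. -/
theorem margin_eq (h : N.Acyclic) {J : Finset E} (hJ : J.Nonempty) {r : E → ℝ} {μ : ℝ}
    (hX : (N.feasible J r μ).Nonempty) :
    margin h J r μ = sSup ((fun x => J.attach.inf' hJ.attach
      (fun e => linkMargin h e.1 (x e.1) + margin h (J.erase e.1) x μ)) '' N.feasible J r μ) := by
  rw [margin, setMargin, dif_pos hJ, if_pos hX]
  rfl

theorem setMargin_congr {l₁ l₂ : E → ℝ → ℝ} (J : Finset E) (hl : ∀ e ∈ J, l₁ e = l₂ e)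
    (r : E → ℝ) (μ : ℝ) : N.setMargin l₁ J r μ = N.setMargin l₂ J r μ := by
  induction hn : J.card using Nat.strong_induction_on generalizing J r with
  | _ n ih =>
    subst hn
    rw [setMargin, setMargin]
    split_ifs with hJ hX
    · congr 2
      funext x
      congr 1
      funext e
      rw [hl e.1 e.2, ih _ (Finset.card_erase_lt_of_mem e.2) _
        (fun e' he' => hl e' (Finset.mem_of_mem_erase he')) x rfl]
    · rfl
    · rfl

variable {N} in
/-- The value at a node is `S(E⁺_v, 0, μ)`. -/
theorem nodeMargin_eq (h : N.Acyclic) (v : V) (μ : ℝ) :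
    nodeMargin h v μ = margin h (N.outLinks v) 0 μ := by
  rw [nodeMargin, WellFounded.fix_eq, margin]
  refine N.setMargin_congr _ (fun e he => ?_) _ _
  have ht : N.tail e = v := by simpa [outLinks] using he
  funext x
  by_cases hd : N.head e = N.dest
  · simp [linkMargin, hd]
  · simp [linkMargin, hd, ht, nodeMargin]

variable {N} in
/-- The maximizers in the recursive step at `J`. -/
def maximizers (h : N.Acyclic) (J : Finset E) (r : E → ℝ) (μ : ℝ) : Set (E → ℝ) :=
  {x | x ∈ N.feasible J r μ ∧ ∃ hJ : J.Nonempty, IsMaxOn (fun y => J.attach.inf' hJ.attach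
    (fun e => linkMargin h e.1 (y e.1) + margin h (J.erase e.1) y μ)) (N.feasible J r μ) x}

variable {N} in
/-- The policy is a BPA routing: with all links of a node active it uses a maximizer for the lower
bound `0`, and with a proper subset of them active a maximizer for the lower bound `r*` given by its
own action with all links active and the same inflow.  If no vector is feasible (the inflow is too
large for the capacities), then there is no maximizer, and the action is only restricted by the
definition of a routing policy. -/
def RoutingPolicy.IsBPA (h : N.Acyclic) (G : N.RoutingPolicy) : Prop :=
  ∀ v, v ≠ N.dest → ∀ μ, 0 ≤ μ →
    ((N.feasible (N.outLinks v) 0 μ).Nonempty →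
      G.split v (N.outLinks v) μ ∈ maximizers h (N.outLinks v) 0 μ) ∧
    ∀ J ⊂ N.outLinks v, J.Nonempty →
      (N.feasible J (G.split v (N.outLinks v) μ) μ).Nonempty →
      G.split v J μ ∈ maximizers h J (G.split v (N.outLinks v) μ) μ

/-! ### The network flow dynamics -/

/-- The state of the network: active non-destination nodes, active links, link flows and residual
link capacities. -/
structure State (V E : Type*) where
  nodes : Finset V
  links : Finset E
  flow : E → ℝ
  resCap : E → ℝ

/-- The active links going out of `v`. -/
def activeOut (s : State V E) (v : V) : Finset E := N.outLinks v ∩ s.links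

/-- The current inflow at `v`, external and from active links. -/
def currentInflow (lam : ℝ) (s : State V E) (v : V) : ℝ :=
  N.extInflow lam v + ∑ e ∈ N.inLinks v ∩ s.links, s.flow e

/-- `f` is the initial flow specified by the policy: every non-destination node splits its inflow
among all its outgoing links as the policy prescribes.  (In particular `f` conserves mass at every
non-destination node.) -/
structure IsInitialFlow (G : N.RoutingPolicy) (lam : ℝ) (f : E → ℝ) : Prop where
  nonneg : ∀ e, 0 ≤ f e
  routed : ∀ v, v ≠ N.dest → ∀ e ∈ N.outLinks v,
    f e = G.split v (N.outLinks v) (N.extInflow lam v + ∑ e' ∈ N.inLinks v, f e') e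

/-- The initial state: all non-destination nodes and all links are active. -/
def initState (f₀ : E → ℝ) : State V E where
  nodes := Finset.univ.erase N.dest
  links := Finset.univ
  flow := f₀
  resCap := N.cap

/-- One step of the dynamics, with capacity reduction `d`.  The destination never becomes
inactive. -/
def nextState (G : N.RoutingPolicy) (lam : ℝ) (s : State V E) (d : E → ℝ) : State V E where
  nodes := s.nodes.filter (fun v => N.activeOut s v ≠ ∅)
  links := s.links.filter (fun e =>
    ¬ (s.resCap e ≤ s.flow e) ∧ ¬ (N.head e ≠ N.dest ∧ N.head e ∉ s.nodes))
  flow := fun e => if N.tail e ∈ s.nodes ∧ e ∈ s.links then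
      G.split (N.tail e) (N.activeOut s (N.tail e)) (N.currentInflow lam s (N.tail e)) e
    else 0
  resCap := fun e => s.resCap e - d e

/-- The trajectory under the disturbance process `δ 1, δ 2, …` (the value `δ 0` is not used). -/
def trajectory (G : N.RoutingPolicy) (lam : ℝ) (f₀ : E → ℝ) (δ : ℕ → E → ℝ) : ℕ → State V E
  | 0 => N.initState f₀
  | t + 1 => N.nextState G lam (trajectory G lam f₀ δ t) (δ (t + 1))

/-- `δ 1, δ 2, …` is a disturbance process: nonnegative capacity reductions whose sums up to any
time do not exceed the capacities. -/
structure IsDisturbance (δ : ℕ → E → ℝ) : Prop where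
  nonneg : ∀ t, 1 ≤ t → ∀ e, 0 ≤ δ t e
  sum_le : ∀ t e, ∑ s ∈ Finset.Icc 1 t, δ s e ≤ N.cap e

/-- The dynamics is transferring: the flow arriving at the destination tends to the inflow. -/
def IsTransferring (G : N.RoutingPolicy) (lam : ℝ) (f₀ : E → ℝ) (δ : ℕ → E → ℝ) : Prop :=
  Tendsto (fun t => ∑ e ∈ N.inLinks N.dest, (N.trajectory G lam f₀ δ t).flow e) atTop (𝓝 lam)

end Network

/-- The magnitude of a disturbance process: the sum over all links of the total capacity reduction
over all times `t ≥ 1`. (For a disturbance process the series converge.) -/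
def magnitude {E : Type*} [Fintype E] (δ : ℕ → E → ℝ) : ℝ := ∑ e, ∑' t, δ (t + 1) e

end CascadingFailure

end

/-!
The margins price the damage that a failure costs.  By induction towards the origin, a link `e` that
fails while the path to it is active has margin `S_e` at its flow at most the total disturbance on
the links downstream of `e`.  Either its capacity was exceeded, which takes at least `C_e` minus
the flow, or its head became inactive.  If all links out of a node have failed, the policy is
followed along the order of failures: of any set `J` of these links, the first to fail carried at
most what the policy assigns to it when exactly `J` is active and the inflow is the latest one,
because the inflow of a node grows as long as the path to it is active.  The recursion for `S` then
bounds the margin of the node by the sum of the costs of its links.  On a tree the links downstream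
of different links of a node are disjoint, so no disturbance is counted twice, and the loss of the
origin would cost `S*`.

If the origin is never lost, the active sets and then the flows become constant, since the network
has no directed cycle, and conservation of mass forces the flow into the destination to be `λ`.
-/

namespace CascadingFailure

theorem eventuallyConst_sum {ι α M : Type*} [AddCommMonoid M] {l : Filter α} {s : Finset ι}
    {f : α → ι → M} (hf : ∀ i ∈ s, EventuallyConst (fun a => f a i) l) :
    EventuallyConst (fun a => ∑ i ∈ s, f a i) l := by
  classical
  induction s using Finset.induction_on with
  | empty => exact EventuallyConst.const 0
  | insert i s hi ih =>
    simp only [Finset.sum_insert hi]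
    exact (hf i (Finset.mem_insert_self i s)).add
      (ih fun j hj => hf j (Finset.mem_insert_of_mem hj))

theorem eventuallyConst_of_antitone {α : Type*} [PartialOrder α] [WellFoundedLT α] {a : ℕ → α}
    (ha : Antitone a) : EventuallyConst a atTop :=
  eventuallyConst_atTop.2 <| (WellFoundedLT.antitone_chain_condition ha).imp fun _ hn m hm =>
    (hn m hm).symm

end CascadingFailure

namespace CascadingFailure.Network

section SetMargin

variable {V E : Type*} {N : Network V E} {J : Finset E} {r r' : E → ℝ} {μ μ' : ℝ}

theorem exists_mem_feasible_le {x' : E → ℝ} (hx' : x' ∈ N.feasible J r' μ')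
    (hr : ∀ e ∈ J, 0 ≤ r e) (hrr' : ∀ e ∈ J, r e ≤ r' e) (hsum : ∑ e ∈ J, r e ≤ μ)
    (hμ : μ ≤ μ') : ∃ x ∈ N.feasible J r μ, ∀ e ∈ J, x e ≤ x' e := by
  classical
  obtain ⟨hbounds', -, hsum'⟩ := hx'
  -- By the intermediate value property, some point of the segment from `r` to `x'` has total `μ`.
  obtain ⟨θ, ⟨hθ₀, hθ₁⟩, hθ⟩ : ∃ θ ∈ Set.Icc (0 : ℝ) 1,
      ∑ e ∈ J, (r e + θ * (x' e - r e)) = μ := by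
    refine intermediate_value_Icc (f := fun θ : ℝ => ∑ e ∈ J, (r e + θ * (x' e - r e)))
      zero_le_one (by fun_prop) ⟨by simpa using hsum, by simpa [hsum'] using hμ⟩
  have hrx' : ∀ e ∈ J, 0 ≤ x' e - r e := fun e he =>
    sub_nonneg.2 ((hrr' e he).trans (hbounds' e he).2.1)
  have hlow : ∀ e ∈ J, r e ≤ r e + θ * (x' e - r e) := fun e he =>
    le_add_of_nonneg_right (mul_nonneg hθ₀ (hrx' e he))
  have hup : ∀ e ∈ J, r e + θ * (x' e - r e) ≤ x' e := fun e he => by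
    linarith [mul_le_of_le_one_left (hrx' e he) hθ₁]
  refine ⟨fun e => if e ∈ J then r e + θ * (x' e - r e) else 0,
    ⟨fun e he => ?_, fun e he => if_neg he, ?_⟩, fun e he => ?_⟩
  · simp only [if_pos he]
    exact ⟨(hr e he).trans (hlow e he), hlow e he, (hup e he).trans (hbounds' e he).2.2⟩
  · rw [← hθ]
    exact Finset.sum_congr rfl fun e he => if_pos he
  · simp only [if_pos he]
    exact hup e he

variable [DecidableEq E] {link : E → ℝ → ℝ}

/-- The function of `x` that the recursive step of the Backward Propagation Algorithm at `J`
maximizes.  The minimum runs over `J.attach` so that it is definitionally the one in `setMargin`. -/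
noncomputable def stepValue (N : Network V E) (link : E → ℝ → ℝ) (hJ : J.Nonempty) (μ : ℝ)
    (x : E → ℝ) : ℝ :=
  J.attach.inf' hJ.attach fun e => link e.1 (x e.1) + N.setMargin link (J.erase e.1) x μ

theorem stepValue_le (hJ : J.Nonempty) (x : E → ℝ) {e : E} (he : e ∈ J) :
    N.stepValue link hJ μ x ≤ link e (x e) + N.setMargin link (J.erase e) x μ :=
  Finset.inf'_le (fun e : J => link e.1 (x e.1) + N.setMargin link (J.erase e.1) x μ)
    (Finset.mem_attach J ⟨e, he⟩)

theorem le_stepValue (hJ : J.Nonempty) {x : E → ℝ} {a : ℝ}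
    (ha : ∀ e ∈ J, a ≤ link e (x e) + N.setMargin link (J.erase e) x μ) :
    a ≤ N.stepValue link hJ μ x :=
  Finset.le_inf' _ _ fun e _ => ha e.1 e.2

theorem setMargin_empty : N.setMargin link ∅ r μ = 0 := by
  rw [setMargin, dif_neg Finset.not_nonempty_empty]

theorem setMargin_of_not_nonempty_feasible (hX : ¬ (N.feasible J r μ).Nonempty) :
    N.setMargin link J r μ = 0 := by
  rw [setMargin]
  split_ifs <;> rfl

theorem setMargin_eq_sSup (hJ : J.Nonempty) (hX : (N.feasible J r μ).Nonempty) :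
    N.setMargin link J r μ = sSup (N.stepValue link hJ μ '' N.feasible J r μ) := by
  rw [setMargin, dif_pos hJ, if_pos hX]
  rfl

theorem setMargin_le {a : ℝ} (ha : 0 ≤ a)
    (hstep : ∀ hJ : J.Nonempty, ∀ x ∈ N.feasible J r μ, N.stepValue link hJ μ x ≤ a) :
    N.setMargin link J r μ ≤ a := by
  rcases J.eq_empty_or_nonempty with rfl | hJ
  · rwa [setMargin_empty]
  by_cases hX : (N.feasible J r μ).Nonempty
  · rw [setMargin_eq_sSup hJ hX]
    exact csSup_le (hX.image _) (Set.forall_mem_image.2 (hstep hJ))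
  · rwa [setMargin_of_not_nonempty_feasible hX]

theorem stepValue_le_sum_cap (hlink : ∀ e ∈ J, ∀ x, link e x ≤ N.cap e - x) (hJ : J.Nonempty)
    {x : E → ℝ} (hx : x ∈ N.feasible J r μ)
    (hrest : ∀ e ∈ J, N.setMargin link (J.erase e) x μ ≤ ∑ k ∈ J.erase e, N.cap k) :
    N.stepValue link hJ μ x ≤ ∑ k ∈ J, N.cap k := by
  obtain ⟨e, he⟩ := id hJ
  calc N.stepValue link hJ μ x ≤ link e (x e) + N.setMargin link (J.erase e) x μ :=
        stepValue_le hJ x he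
    _ ≤ N.cap e + ∑ k ∈ J.erase e, N.cap k :=
        add_le_add ((hlink e he _).trans (sub_le_self _ (hx.1 e he).1)) (hrest e he)
    _ = ∑ k ∈ J, N.cap k := Finset.add_sum_erase J N.cap he

theorem setMargin_le_sum_cap (hlink : ∀ e ∈ J, ∀ x, link e x ≤ N.cap e - x) :
    N.setMargin link J r μ ≤ ∑ k ∈ J, N.cap k := by
  induction J using Finset.strongInduction generalizing r with
  | H J ih =>
    refine setMargin_le (Finset.sum_nonneg fun e _ => (N.cap_pos e).le) fun hJ x hx => ?_
    exact stepValue_le_sum_cap hlink hJ hx fun e he =>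
      ih _ (Finset.erase_ssubset he) fun k hk => hlink k (Finset.mem_of_mem_erase hk)

theorem stepValue_le_setMargin (hlink : ∀ e ∈ J, ∀ x, link e x ≤ N.cap e - x) (hJ : J.Nonempty)
    {x : E → ℝ} (hx : x ∈ N.feasible J r μ) :
    N.stepValue link hJ μ x ≤ N.setMargin link J r μ := by
  rw [setMargin_eq_sSup hJ ⟨x, hx⟩]
  refine le_csSup ⟨∑ k ∈ J, N.cap k, Set.forall_mem_image.2 fun y hy => ?_⟩
    (Set.mem_image_of_mem _ hx)
  exact stepValue_le_sum_cap hlink hJ hy fun e _ =>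
    setMargin_le_sum_cap fun k hk => hlink k (Finset.mem_of_mem_erase hk)

theorem setMargin_nonneg (hlink : ∀ e ∈ J, ∀ x ≤ N.cap e, 0 ≤ link e x) :
    0 ≤ N.setMargin link J r μ := by
  induction J using Finset.strongInduction generalizing r with
  | H J ih =>
    rcases J.eq_empty_or_nonempty with rfl | hJ
    · rw [setMargin_empty]
    by_cases hX : (N.feasible J r μ).Nonempty
    · rw [setMargin_eq_sSup hJ hX]
      refine Real.sSup_nonneg (Set.forall_mem_image.2 fun x hx => le_stepValue hJ fun e he => ?_)
      exact add_nonneg (hlink e he _ (hx.1 e he).2.2)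
        (ih _ (Finset.erase_ssubset he) fun k hk => hlink k (Finset.mem_of_mem_erase hk))
    · rw [setMargin_of_not_nonempty_feasible hX]

theorem setMargin_anti (hle : ∀ e ∈ J, ∀ x, link e x ≤ N.cap e - x)
    (hnonneg : ∀ e ∈ J, ∀ x ≤ N.cap e, 0 ≤ link e x)
    (hanti : ∀ e ∈ J, AntitoneOn (link e) (Set.Ici 0))
    (hr : ∀ e ∈ J, 0 ≤ r e) (hrr' : ∀ e ∈ J, r e ≤ r' e) (hsum : ∑ e ∈ J, r e ≤ μ)
    (hμ : μ ≤ μ') : N.setMargin link J r' μ' ≤ N.setMargin link J r μ := by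
  induction J using Finset.strongInduction generalizing r r' with
  | H J ih =>
    refine setMargin_le (setMargin_nonneg hnonneg) fun hJ x' hx' => ?_
    obtain ⟨x, hx, hxx'⟩ := exists_mem_feasible_le hx' hr hrr' hsum hμ
    refine (le_stepValue hJ fun e he => ?_).trans (stepValue_le_setMargin hle hJ hx)
    have hsub : J.erase e ⊆ J := Finset.erase_subset e J
    have hsum_erase : ∑ k ∈ J.erase e, x k ≤ μ := by
      rw [← hx.2.2, ← Finset.add_sum_erase J x he]
      exact le_add_of_nonneg_left (hx.1 e he).1
    have hrest : N.setMargin link (J.erase e) x' μ' ≤ N.setMargin link (J.erase e) x μ :=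
      ih _ (Finset.erase_ssubset he) (fun k hk => hle k (hsub hk))
        (fun k hk => hnonneg k (hsub hk)) (fun k hk => hanti k (hsub hk))
        (fun k hk => (hx.1 k (hsub hk)).1) (fun k hk => hxx' k (hsub hk)) hsum_erase
    exact (stepValue_le hJ x' he).trans
      (add_le_add (hanti e he (hx.1 e he).1 (hx'.1 e he).1 (hxx' e he)) hrest)

end SetMargin

section LinkSets

variable {V E : Type*} [Fintype E] [DecidableEq V] {N : Network V E}

@[simp] theorem mem_outLinks {v : V} {e : E} : e ∈ N.outLinks v ↔ N.tail e = v := by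
  simp [outLinks]

@[simp] theorem mem_inLinks {v : V} {e : E} : e ∈ N.inLinks v ↔ N.head e = v := by
  simp [inLinks]

end LinkSets

section LinkMargin

variable {V E : Type*} [Fintype V] [Fintype E] [DecidableEq V] [DecidableEq E] {N : Network V E}
  {h : N.Acyclic}

theorem linkMargin_le_cap_sub (e : E) (x : ℝ) : linkMargin h e x ≤ N.cap e - x := by
  rw [linkMargin]
  split_ifs
  exacts [le_rfl, min_le_left _ _]

theorem linkMargin_nonneg {e : E} {x : ℝ} (hx : x ≤ N.cap e) : 0 ≤ linkMargin h e x := by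
  induction hw : N.head e using h.wf.induction generalizing e x with
  | _ w ih =>
    subst hw
    rw [linkMargin]
    split_ifs
    · exact sub_nonneg.2 hx
    · refine le_min (sub_nonneg.2 hx) ?_
      rw [nodeMargin_eq]
      exact setMargin_nonneg fun k hk y hy => ih _ ⟨k, mem_outLinks.1 hk, rfl⟩ hy rfl

theorem linkMargin_antitoneOn (e : E) : AntitoneOn (linkMargin h e) (Set.Ici 0) := by
  induction hw : N.head e using h.wf.induction generalizing e with
  | _ w ih =>
    subst hw
    intro x hx y _ hxy
    simp only [linkMargin]
    split_ifs
    · exact sub_le_sub_left hxy _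
    · refine min_le_min (sub_le_sub_left hxy _) ?_
      rw [nodeMargin_eq, nodeMargin_eq]
      exact setMargin_anti (fun k _ => linkMargin_le_cap_sub k) (fun _ _ _ => linkMargin_nonneg)
        (fun k hk => ih _ ⟨k, mem_outLinks.1 hk, rfl⟩ k rfl) (fun _ _ => le_rfl)
        (fun _ _ => le_rfl) (by simpa using hx) hxy

theorem margin_le_of_mem_maximizers {J : Finset E} {r x : E → ℝ} {μ : ℝ}
    (hx : x ∈ maximizers h J r μ) {e : E} (he : e ∈ J) :
    margin h J r μ ≤ linkMargin h e (x e) + margin h (J.erase e) x μ := by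
  obtain ⟨hfeas, hJ, hmax⟩ := hx
  refine le_trans ?_ (stepValue_le hJ x he)
  rw [margin, setMargin_eq_sSup hJ ⟨x, hfeas⟩]
  exact csSup_le (Set.Nonempty.image _ ⟨x, hfeas⟩) (Set.forall_mem_image.2 fun y hy => hmax hy)

end LinkMargin

section SequentiallyOptimal

variable {V E : Type*} [Fintype V] [Fintype E] [DecidableEq V] [DecidableEq E] {N : Network V E}
  {h : N.Acyclic} {G : N.RoutingPolicy} {v : V} {μ : ℝ}

/-- Sequential optimality of a routing policy: with all links of a node active it uses a maximizer
for the lower bound `0`, and after every further loss of a link `e` from the active set `K` a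
maximizer for the lower bound given by its action at `K`.  In contrast to a BPA routing, which is
compared with its action at the full set of links only, such a policy follows the recursion of the
algorithm along every order of failures. -/
structure RoutingPolicy.IsSequentiallyOptimal (h : N.Acyclic) (G : N.RoutingPolicy) : Prop where
  outLinks_mem_maximizers : ∀ v, v ≠ N.dest → ∀ μ, 0 ≤ μ →
    (N.feasible (N.outLinks v) 0 μ).Nonempty →
    G.split v (N.outLinks v) μ ∈ maximizers h (N.outLinks v) 0 μ
  erase_mem_maximizers : ∀ v, v ≠ N.dest → ∀ μ, 0 ≤ μ → ∀ K ⊆ N.outLinks v, ∀ e ∈ K,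
    (K.erase e).Nonempty → (N.feasible (K.erase e) (G.split v K μ) μ).Nonempty →
    G.split v (K.erase e) μ ∈ maximizers h (K.erase e) (G.split v K μ) μ

theorem RoutingPolicy.split_singleton_mem_maximizers (G : N.RoutingPolicy) (hv : v ≠ N.dest)
    (hμ : 0 ≤ μ) {e : E} (he : e ∈ N.outLinks v) {r : E → ℝ}
    (hX : (N.feasible {e} r μ).Nonempty) : G.split v {e} μ ∈ maximizers h {e} r μ := by
  have hsub : {e} ⊆ N.outLinks v := Finset.singleton_subset_iff.2 he
  have hne : ({e} : Finset E).Nonempty := Finset.singleton_nonempty e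
  have huniq : ∀ x ∈ N.feasible {e} r μ, x = G.split v {e} μ := by
    rintro x ⟨-, hsupp, hsum⟩
    funext k
    by_cases hk : k ∈ ({e} : Finset E)
    · have hsplit := G.sum_eq v hv {e} hsub hne μ hμ
      rw [Finset.sum_singleton] at hsum hsplit
      rw [Finset.mem_singleton.1 hk, hsum, hsplit]
    · rw [hsupp k hk, G.support v hv {e} hsub hne μ hμ k hk]
  obtain ⟨x, hx⟩ := hX
  exact ⟨huniq x hx ▸ hx, hne, isMaxOn_iff.2 fun y hy => by rw [huniq y hy]⟩

/-- With at most three outgoing links, BPA covers the loss of a first link, and after the loss of a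
second one at most one link is left, so that the action is forced. -/
theorem RoutingPolicy.IsBPA.isSequentiallyOptimal (hG : G.IsBPA h)
    (hdeg : ∀ v, v ≠ N.dest → (N.outLinks v).card ≤ 3) : G.IsSequentiallyOptimal h where
  outLinks_mem_maximizers v hv μ hμ := (hG v hv μ hμ).1
  erase_mem_maximizers v hv μ hμ K hK e he hne hX := by
    rcases hK.eq_or_ssubset with rfl | hssub
    · exact (hG v hv μ hμ).2 _ (Finset.erase_ssubset he) hne hX
    · have hcard : (K.erase e).card = 1 := by
        have := Finset.card_lt_card hssub
        have := hdeg v hv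
        have := Finset.card_erase_of_mem he
        have := hne.card_pos
        omega
      obtain ⟨k, hk⟩ := Finset.card_eq_one.1 hcard
      have hkv : k ∈ N.outLinks v :=
        hK (Finset.erase_subset e K (hk ▸ Finset.mem_singleton_self k))
      rw [hk] at hX ⊢
      exact G.split_singleton_mem_maximizers hv hμ hkv hX

theorem RoutingPolicy.IsSequentiallyOptimal.margin_outLinks_le (hG : G.IsSequentiallyOptimal h)
    (hv : v ≠ N.dest) (hμ : 0 ≤ μ) {D : E → ℝ} (hD : ∀ e, 0 ≤ D e)
    (hcost : ∀ J ⊆ N.outLinks v, J.Nonempty → ∃ e ∈ J, linkMargin h e (G.split v J μ e) ≤ D e) :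
    margin h (N.outLinks v) 0 μ ≤ ∑ e ∈ N.outLinks v, D e := by
  have key : ∀ J ⊆ N.outLinks v, ∀ r : E → ℝ,
      (J.Nonempty → (N.feasible J r μ).Nonempty → G.split v J μ ∈ maximizers h J r μ) →
      margin h J r μ ≤ ∑ e ∈ J, D e := by
    intro J
    induction J using Finset.strongInduction with
    | H J ih =>
      intro hJ r hmax
      rcases J.eq_empty_or_nonempty with rfl | hne
      · rw [margin, setMargin_empty, Finset.sum_empty]
      by_cases hX : (N.feasible J r μ).Nonempty
      · obtain ⟨e, he, hle⟩ := hcost J hJ hne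
        calc margin h J r μ
            ≤ linkMargin h e (G.split v J μ e) + margin h (J.erase e) (G.split v J μ) μ :=
              margin_le_of_mem_maximizers (hmax hne hX) he
          _ ≤ D e + ∑ k ∈ J.erase e, D k :=
              add_le_add hle (ih _ (Finset.erase_ssubset he) ((Finset.erase_subset e J).trans hJ) _
                (hG.erase_mem_maximizers v hv μ hμ J hJ e he))
          _ = ∑ k ∈ J, D k := Finset.add_sum_erase J D he
      · rw [margin, setMargin_of_not_nonempty_feasible hX]
        exact Finset.sum_nonneg fun e _ => hD e
  exact key _ subset_rfl 0 fun _ => hG.outLinks_mem_maximizers v hv μ hμ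

end SequentiallyOptimal

section Tree

variable {V E : Type*} {N : Network V E}

theorem head_ne_origin (e : E) : N.head e ≠ N.origin :=
  (N.origin_iff N.origin).2 rfl e

theorem IsTree.coreGraph_adj (h : N.IsTree) {e : E} (he : N.head e ≠ N.dest) :
    N.coreGraph.Adj ⟨N.tail e, tail_ne_dest e⟩ ⟨N.head e, he⟩ :=
  (SimpleGraph.fromRel_adj _ _ _).2
    ⟨fun heq => h.no_loop e he (congrArg Subtype.val heq), Or.inl ⟨e, rfl, rfl⟩⟩

/-- Counting: the links of the tree inject into its edges, of which there are as many as nodes other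
than the origin, and every such node is the head of a link. -/
theorem IsTree.head_injOn [Finite V] [Finite E] (h : N.IsTree) :
    Set.InjOn N.head {e | N.head e ≠ N.dest} := by
  classical
  let o : {v // v ≠ N.dest} := ⟨N.origin, N.origin_ne_dest⟩
  let toEdge (e : {e // N.head e ≠ N.dest}) : N.coreGraph.edgeSet :=
    ⟨s(_, _), h.coreGraph_adj e.2⟩
  let toNode (e : {e // N.head e ≠ N.dest}) : {v // v ≠ o} :=
    ⟨⟨N.head e, e.2⟩, fun ho => head_ne_origin e.1 (congrArg Subtype.val ho)⟩
  have toEdge_injective : Function.Injective toEdge := fun e e' hee' =>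
    Subtype.ext (h.no_parallel e e' e.2 e'.2
      (congrArg (fun p : N.coreGraph.edgeSet => Sym2.map Subtype.val p.1) hee'))
  have toNode_surjective : Function.Surjective toNode := by
    rintro ⟨⟨v, hv⟩, hvo⟩
    obtain ⟨e, rfl⟩ : ∃ e, N.head e = v := by
      by_contra! hne
      exact hvo (Subtype.ext ((N.origin_iff v).1 hne))
    exact ⟨⟨e, hv⟩, rfl⟩
  have card_le : Nat.card {e // N.head e ≠ N.dest} ≤ Nat.card {v // v ≠ o} := by
    have hcard := (SimpleGraph.isTree_iff_connected_and_card.1 h.isTree).2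
    have hlinks := Nat.card_le_card_of_injective toEdge toEdge_injective
    have hnodes := Nat.card_congr (Equiv.optionSubtypeNe o)
    rw [Finite.card_option] at hnodes
    omega
  intro e he e' he' hee'
  exact congrArg Subtype.val ((toNode_surjective.bijective_of_nat_card_le card_le).1
    (a₁ := ⟨e, he⟩) (a₂ := ⟨e', he'⟩) (Subtype.ext (Subtype.ext hee')))

theorem Acyclic.wellFounded_step [Finite V] (h : N.Acyclic) : WellFounded N.Step := by
  have : Std.Irrefl (Relation.TransGen N.Step) := ⟨h⟩
  exact Subrelation.wf Relation.TransGen.single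
    (Finite.wellFounded_of_trans_of_irrefl (Relation.TransGen N.Step))

/-- There is a directed path whose first link is `e` and whose last link is `k`; this includes the
path that consists of `e` alone. -/
def LinkPath (N : Network V E) : E → E → Prop :=
  Relation.ReflTransGen fun e k => N.head e = N.tail k

theorem LinkPath.reflTransGen_step {e k : E} (hek : N.LinkPath e k) :
    Relation.ReflTransGen N.Step (N.tail e) (N.tail k) :=
  Relation.ReflTransGen.lift N.tail (fun a _ hab => ⟨a, rfl, hab⟩) _ _ hek

theorem Acyclic.eq_of_linkPath (h : N.Acyclic) {e e' : E} (hee' : N.LinkPath e e')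
    (htail : N.tail e = N.tail e') : e = e' := by
  rcases Relation.ReflTransGen.cases_tail hee' with heq | ⟨k, hek, hk⟩
  · exact heq.symm
  · exact (h _ (Relation.TransGen.tail' (LinkPath.reflTransGen_step hek)
      ⟨k, rfl, hk.trans htail.symm⟩)).elim

theorem IsTree.eq_of_linkPath_of_linkPath [Finite V] [Finite E] (h : N.IsTree) {e e' k : E}
    (hk : N.LinkPath e k) (hk' : N.LinkPath e' k) (htail : N.tail e = N.tail e') : e = e' := by
  have huniq : Relator.RightUnique (Function.swap fun a b : E => N.head a = N.tail b) :=
    fun a b c hba hca =>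
      h.head_injOn (hba.trans_ne (tail_ne_dest a)) (hca.trans_ne (tail_ne_dest a))
        (hba.trans hca.symm)
  rcases Relation.ReflTransGen.total_of_right_unique huniq hk.swap hk'.swap with hee' | hee'
  · exact (h.acyclic.eq_of_linkPath hee'.swap htail.symm).symm
  · exact h.acyclic.eq_of_linkPath hee'.swap htail

variable [Fintype E]

open Classical in
/-- The links that can lie on a path starting with the link `e`, including `e` itself: the part of
the network whose damage can lead to the failure of `e`. -/
noncomputable def downstream (N : Network V E) (e : E) : Finset E := {k | N.LinkPath e k}

theorem mem_downstream {e k : E} : k ∈ N.downstream e ↔ N.LinkPath e k := by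
  simp [downstream]

theorem self_mem_downstream (e : E) : e ∈ N.downstream e :=
  mem_downstream.2 Relation.ReflTransGen.refl

theorem downstream_subset_downstream {e k : E} (hek : N.head e = N.tail k) :
    N.downstream k ⊆ N.downstream e := fun _ hl =>
  mem_downstream.2 (Relation.ReflTransGen.head hek (mem_downstream.1 hl))

theorem IsTree.sum_sum_downstream_le [Finite V] [DecidableEq V] (h : N.IsTree) {d : E → ℝ}
    (hd : ∀ e, 0 ≤ d e) {v : V} {s : Finset E} (hs : ∀ e ∈ N.outLinks v, N.downstream e ⊆ s) :
    ∑ e ∈ N.outLinks v, ∑ k ∈ N.downstream e, d k ≤ ∑ k ∈ s, d k := by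
  classical
  have hdisj : (N.outLinks v : Set E).PairwiseDisjoint N.downstream := by
    intro e he e' he' hne
    refine Finset.disjoint_left.2 fun k hk hk' => hne ?_
    exact h.eq_of_linkPath_of_linkPath (mem_downstream.1 hk) (mem_downstream.1 hk')
      ((mem_outLinks.1 he).trans (mem_outLinks.1 he').symm)
  rw [← Finset.sum_biUnion hdisj]
  exact Finset.sum_le_sum_of_subset_of_nonneg (Finset.biUnion_subset.2 hs) fun k _ _ => hd k

end Tree

section State

variable {V E : Type*} {N : Network V E} {s s' : State V E}

/-- The node `v` is reached from the origin by a path of active links.  As long as this holds, the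
inflow of `v` in a tree can only grow. -/
def PathActive (N : Network V E) (s : State V E) (v : V) : Prop :=
  Relation.ReflTransGen (fun u w => ∃ e ∈ s.links, N.tail e = u ∧ N.head e = w) N.origin v

theorem PathActive.mono (hs : s'.links ⊆ s.links) {v : V} (hv : N.PathActive s' v) :
    N.PathActive s v :=
  Relation.ReflTransGen.mono (fun _ _ ⟨e, he, hstep⟩ => ⟨e, hs he, hstep⟩) _ _ hv

theorem PathActive.head {e : E} (hp : N.PathActive s (N.tail e)) (he : e ∈ s.links) :
    N.PathActive s (N.head e) :=
  Relation.ReflTransGen.tail hp ⟨e, he, rfl, rfl⟩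

theorem PathActive.eq_origin_or {v : V} (hp : N.PathActive s v) :
    v = N.origin ∨ ∃ e ∈ s.links, N.head e = v ∧ N.PathActive s (N.tail e) := by
  rcases Relation.ReflTransGen.cases_tail hp with horigin | ⟨u, hu, e, he, rfl, rfl⟩
  · exact Or.inl horigin
  · exact Or.inr ⟨e, he, rfl, hu⟩

variable [Fintype E] [DecidableEq V]

theorem split_le_split {G : N.RoutingPolicy} (hmono : G.FlowMonotone) {v : V} (hv : v ≠ N.dest)
    {J K : Finset E} (hJ : J ⊆ N.outLinks v) (hK : K ⊆ J) {μ μ' : ℝ} (hμ : 0 ≤ μ) (hμ' : μ ≤ μ')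
    (ho : v = N.origin → μ = μ') {e : E} (he : e ∈ K) : G.split v J μ e ≤ G.split v K μ' e := by
  refine (G.link_mono v hv J hJ K hK ⟨e, he⟩ μ hμ e he).trans ?_
  by_cases hvo : v = N.origin
  · rw [ho hvo]
  · exact hmono v hvo hv K (hK.trans hJ) ⟨e, he⟩ μ μ' hμ hμ' e he

variable [DecidableEq E] {lam : ℝ}

@[simp] theorem mem_activeOut {v : V} {e : E} :
    e ∈ N.activeOut s v ↔ N.tail e = v ∧ e ∈ s.links := by
  simp [activeOut]

theorem activeOut_subset (s : State V E) (v : V) : N.activeOut s v ⊆ N.outLinks v :=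
  Finset.inter_subset_left

theorem currentInflow_nonneg (hlam : 0 ≤ lam) (hs : ∀ e, 0 ≤ s.flow e) (v : V) :
    0 ≤ N.currentInflow lam s v :=
  add_nonneg (ite_nonneg hlam le_rfl) (Finset.sum_nonneg fun e _ => hs e)

theorem currentInflow_origin (s : State V E) : N.currentInflow lam s N.origin = lam := by
  have hempty : N.inLinks N.origin = ∅ :=
    Finset.eq_empty_of_forall_notMem fun e he => head_ne_origin e (mem_inLinks.1 he)
  simp [currentInflow, extInflow, hempty]

theorem IsTree.currentInflow_head [Finite V] (h : N.IsTree) {e : E} (hd : N.head e ≠ N.dest)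
    (he : e ∈ s.links) : N.currentInflow lam s (N.head e) = s.flow e := by
  have hsingle : N.inLinks (N.head e) ∩ s.links = {e} := by
    refine Finset.eq_singleton_iff_unique_mem.2 ⟨by simp [he], fun k hk => ?_⟩
    have hke : N.head k = N.head e := mem_inLinks.1 (Finset.mem_inter.1 hk).1
    exact h.head_injOn (hke.trans_ne hd) hd hke
  simp [currentInflow, extInflow, hsingle, head_ne_origin]

theorem IsTree.currentInflow_le [Finite V] (h : N.IsTree) {s'' : State V E} {v : V}
    (hv : v ≠ N.dest) (hp : N.PathActive s'' v) (hs : s''.links ⊆ s.links)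
    (hs' : s''.links ⊆ s'.links)
    (hle : ∀ e ∈ s''.links, N.PathActive s'' (N.tail e) → s.flow e ≤ s'.flow e) :
    N.currentInflow lam s v ≤ N.currentInflow lam s' v := by
  rcases hp.eq_origin_or with rfl | ⟨e, he, rfl, hpe⟩
  · rw [currentInflow_origin, currentInflow_origin]
  · rw [h.currentInflow_head hv (hs he), h.currentInflow_head hv (hs' he)]
    exact hle e he hpe

theorem sum_currentInflow_add_sum_inLinks_dest {W : Finset V} (ho : N.origin ∈ W)
    (hd : N.dest ∉ W) (hhead : ∀ e ∈ s.links, N.head e = N.dest ∨ N.head e ∈ W)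
    (hzero : ∀ e ∉ s.links, s.flow e = 0) :
    ∑ v ∈ W, N.currentInflow lam s v + ∑ e ∈ N.inLinks N.dest, s.flow e =
      lam + ∑ e, s.flow e := by
  have hinflow (v : V) :
      N.currentInflow lam s v = N.extInflow lam v + ∑ e ∈ N.inLinks v, s.flow e := by
    rw [currentInflow, Finset.sum_subset Finset.inter_subset_left fun e hin hout =>
      hzero e fun he => hout (Finset.mem_inter.2 ⟨hin, he⟩)]
  have hext : ∑ v ∈ W, N.extInflow lam v = lam := by
    simp only [extInflow, Finset.sum_ite_eq', if_pos ho]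
  have hflow : ∑ v ∈ insert N.dest W, ∑ e ∈ N.inLinks v, s.flow e = ∑ e, s.flow e := by
    simp only [inLinks]
    rw [Finset.sum_fiberwise_eq_sum_filter]
    refine Finset.sum_filter_of_ne fun e _ hne => Finset.mem_insert.2 (hhead e ?_)
    exact not_imp_comm.1 (hzero e) hne
  rw [Finset.sum_insert hd] at hflow
  rw [Finset.sum_congr rfl fun v _ => hinflow v, Finset.sum_add_distrib, hext, ← hflow]
  ring

end State

section Disturbance

variable {V E : Type*} {N : Network V E} {δ : ℕ → E → ℝ}

theorem IsDisturbance.sum_range_le (hδ : N.IsDisturbance δ) (t : ℕ) (e : E) :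
    ∑ r ∈ Finset.range t, δ (r + 1) e ≤ N.cap e := by
  rw [Finset.range_eq_Ico, Finset.sum_Ico_add' (fun r => δ r e) 0 t 1]
  exact hδ.sum_le t e

theorem IsDisturbance.summable (hδ : N.IsDisturbance δ) (e : E) :
    Summable fun t => δ (t + 1) e :=
  summable_of_sum_range_le (fun t => hδ.nonneg _ t.succ_pos e) fun t => hδ.sum_range_le t e

end Disturbance

section Trajectory

variable {V E : Type*} [Fintype V] [Fintype E] [DecidableEq V] [DecidableEq E] {N : Network V E}
  {G : N.RoutingPolicy} {lam : ℝ} {f₀ : E → ℝ} {δ : ℕ → E → ℝ} {t : ℕ} {v : V} {e : E}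

local notation "𝒮" => trajectory N G lam f₀ δ

theorem mem_nodes_succ :
    v ∈ (𝒮 (t + 1)).nodes ↔ v ∈ (𝒮 t).nodes ∧ (N.activeOut (𝒮 t) v).Nonempty := by
  simp [trajectory, nextState, Finset.nonempty_iff_ne_empty]

theorem mem_links_succ :
    e ∈ (𝒮 (t + 1)).links ↔ e ∈ (𝒮 t).links ∧ (𝒮 t).flow e < (𝒮 t).resCap e ∧
      (N.head e = N.dest ∨ N.head e ∈ (𝒮 t).nodes) := by
  simp [trajectory, nextState, or_iff_not_imp_left]

theorem links_antitone : Antitone fun t => (𝒮 t).links :=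
  antitone_nat_of_succ_le fun _ => Finset.filter_subset _ _

theorem nodes_antitone : Antitone fun t => (𝒮 t).nodes :=
  antitone_nat_of_succ_le fun _ => Finset.filter_subset _ _

theorem mem_links_zero (e : E) : e ∈ (𝒮 0).links := Finset.mem_univ e

theorem ne_dest_of_mem_nodes (hv : v ∈ (𝒮 t).nodes) : v ≠ N.dest :=
  Finset.ne_of_mem_erase (nodes_antitone t.zero_le hv)

theorem tail_mem_nodes (he : e ∈ (𝒮 t).links) : N.tail e ∈ (𝒮 t).nodes := by
  induction t with
  | zero => simp [trajectory, initState, tail_ne_dest]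
  | succ t ih =>
    have he' : e ∈ (𝒮 t).links := links_antitone t.le_succ he
    exact mem_nodes_succ.2 ⟨ih he', e, mem_activeOut.2 ⟨rfl, he'⟩⟩

theorem flow_succ (he : e ∈ (𝒮 t).links) :
    (𝒮 (t + 1)).flow e = G.split (N.tail e) (N.activeOut (𝒮 t) (N.tail e))
      (N.currentInflow lam (𝒮 t) (N.tail e)) e :=
  if_pos ⟨tail_mem_nodes he, he⟩

theorem flow_succ_eq_zero (he : e ∉ (𝒮 t).links) : (𝒮 (t + 1)).flow e = 0 :=
  if_neg fun hactive => he hactive.2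

theorem flow_nonneg (hlam : 0 ≤ lam) (hf₀ : N.IsInitialFlow G lam f₀) (t : ℕ) (e : E) :
    0 ≤ (𝒮 t).flow e := by
  induction t generalizing e with
  | zero => exact hf₀.nonneg e
  | succ t ih =>
    by_cases he : e ∈ (𝒮 t).links
    · rw [flow_succ he]
      exact G.nonneg _ (tail_ne_dest e) _ (activeOut_subset _ _)
        ⟨e, mem_activeOut.2 ⟨rfl, he⟩⟩ _ (currentInflow_nonneg hlam ih _) e
    · rw [flow_succ_eq_zero he]

theorem flow_one (hf₀ : N.IsInitialFlow G lam f₀) (e : E) : (𝒮 1).flow e = f₀ e := by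
  rw [flow_succ (mem_links_zero e), hf₀.routed _ (tail_ne_dest e) e (mem_outLinks.2 rfl)]
  simp [trajectory, initState, activeOut, currentInflow]

theorem exists_mem_links_notMem_links_succ {T : ℕ} (he : e ∉ (𝒮 T).links) :
    ∃ t < T, e ∈ (𝒮 t).links ∧ e ∉ (𝒮 (t + 1)).links := by
  obtain ⟨t, hmem, hnotMem⟩ := Nat.exists_not_and_succ_of_not_zero_of_exists
    (p := fun t => e ∉ (𝒮 t).links) (not_not.2 (mem_links_zero e)) ⟨T, he⟩
  have hmem : e ∈ (𝒮 t).links := not_not.1 hmem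
  exact ⟨t, not_le.1 fun hTt => he (links_antitone hTt hmem), hmem, hnotMem⟩

section Monotonicity

theorem IsTree.flow_le_flow_succ (h : N.IsTree) (hlam : 0 ≤ lam) (hmono : G.FlowMonotone)
    (hf₀ : N.IsInitialFlow G lam f₀) {T : ℕ} (ht : t < T) (he : e ∈ (𝒮 T).links)
    (hp : N.PathActive (𝒮 T) (N.tail e)) : (𝒮 t).flow e ≤ (𝒮 (t + 1)).flow e := by
  induction t generalizing e with
  | zero => exact (flow_one hf₀ e).ge
  | succ t ih =>
    have hlinks {r : ℕ} (hr : r ≤ T) : (𝒮 T).links ⊆ (𝒮 r).links := links_antitone hr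
    rw [flow_succ (hlinks (by omega) he), flow_succ (hlinks (by omega) he)]
    refine split_le_split hmono (tail_ne_dest e) (activeOut_subset _ _)
      (Finset.inter_subset_inter_left (links_antitone t.le_succ))
      (currentInflow_nonneg hlam (flow_nonneg hlam hf₀ _) _) ?_ (fun ho => ?_)
      (mem_activeOut.2 ⟨rfl, hlinks (by omega) he⟩)
    · exact h.currentInflow_le (tail_ne_dest e) hp (hlinks (by omega)) (hlinks (by omega))
        fun k hk hpk => ih (by omega) hk hpk
    · rw [ho, currentInflow_origin, currentInflow_origin]

theorem IsTree.flow_monotoneOn (h : N.IsTree) (hlam : 0 ≤ lam) (hmono : G.FlowMonotone)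
    (hf₀ : N.IsInitialFlow G lam f₀) {T : ℕ} (he : e ∈ (𝒮 T).links)
    (hp : N.PathActive (𝒮 T) (N.tail e)) : MonotoneOn (fun t => (𝒮 t).flow e) (Set.Iic T) :=
  monotoneOn_of_le_add_one Set.ordConnected_Iic fun _ _ _ ht =>
    h.flow_le_flow_succ hlam hmono hf₀ ht he hp

theorem IsTree.currentInflow_monotoneOn (h : N.IsTree) (hlam : 0 ≤ lam) (hmono : G.FlowMonotone)
    (hf₀ : N.IsInitialFlow G lam f₀) {T : ℕ} (hv : v ≠ N.dest) (hp : N.PathActive (𝒮 T) v) :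
    MonotoneOn (fun t => N.currentInflow lam (𝒮 t) v) (Set.Iic T) := fun _ ht _ ht' htt' =>
  h.currentInflow_le hv hp (links_antitone ht) (links_antitone ht') fun _ he hpe =>
    h.flow_monotoneOn hlam hmono hf₀ he hpe ht ht' htt'

theorem IsTree.flow_le_split (h : N.IsTree) (hlam : 0 ≤ lam) (hmono : G.FlowMonotone)
    (hf₀ : N.IsInitialFlow G lam f₀) {T : ℕ} (ht : t ≤ T) (hv : v ≠ N.dest)
    (hp : N.PathActive (𝒮 T) v) {J : Finset E} (he : e ∈ J) (hJ : J ⊆ N.activeOut (𝒮 t) v) :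
    (𝒮 t).flow e ≤ G.split v J (N.currentInflow lam (𝒮 T) v) e := by
  obtain ⟨rfl, -⟩ := mem_activeOut.1 (hJ he)
  have flow_succ_le (r : ℕ) (hr : r ≤ T) (hJr : J ⊆ N.activeOut (𝒮 r) (N.tail e)) :
      (𝒮 (r + 1)).flow e ≤ G.split (N.tail e) J (N.currentInflow lam (𝒮 T) (N.tail e)) e := by
    have hinflow : N.currentInflow lam (𝒮 r) (N.tail e) ≤ N.currentInflow lam (𝒮 T) (N.tail e) :=
      h.currentInflow_monotoneOn hlam hmono hf₀ hv hp hr Set.self_mem_Iic hr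
    rw [flow_succ (mem_activeOut.1 (hJr he)).2]
    refine split_le_split hmono hv (activeOut_subset _ _) hJr
      (currentInflow_nonneg hlam (flow_nonneg hlam hf₀ _) _) hinflow (fun ho => ?_) he
    rw [ho, currentInflow_origin, currentInflow_origin]
  rcases t with _ | t
  · exact (flow_one hf₀ e).ge.trans (flow_succ_le 0 ht hJ)
  · exact flow_succ_le t (by omega)
      (hJ.trans (Finset.inter_subset_inter_left (links_antitone t.le_succ)))

end Monotonicity

section Failure

/-- Among the links of `J`, the first one to fail carried at most what the policy assigns to it when
exactly the links in `J` are active. -/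
theorem IsTree.nodeMargin_le_sum_outLinks (h : N.IsTree) (hlam : 0 ≤ lam)
    (hG : G.IsSequentiallyOptimal h.acyclic) (hmono : G.FlowMonotone)
    (hf₀ : N.IsInitialFlow G lam f₀) {T : ℕ} (hv : v ≠ N.dest) (hp : N.PathActive (𝒮 T) v)
    (hvT : v ∉ (𝒮 T).nodes) {D : E → ℝ} (hD : ∀ e, 0 ≤ D e)
    (hfail : ∀ e ∈ N.outLinks v, ∀ t < T, e ∈ (𝒮 t).links → e ∉ (𝒮 (t + 1)).links →
      linkMargin h.acyclic e ((𝒮 t).flow e) ≤ D e) :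
    nodeMargin h.acyclic v (N.currentInflow lam (𝒮 T) v) ≤ ∑ e ∈ N.outLinks v, D e := by
  have hfailed (e) (he : e ∈ N.outLinks v) : e ∉ (𝒮 T).links := fun heT =>
    hvT (mem_outLinks.1 he ▸ tail_mem_nodes heT)
  choose! τ hτT hmem hnotMem using fun e he =>
    exists_mem_links_notMem_links_succ (hfailed e he)
  rw [nodeMargin_eq]
  refine hG.margin_outLinks_le hv (currentInflow_nonneg hlam (flow_nonneg hlam hf₀ T) v) hD
    fun J hJ hne => ?_
  obtain ⟨e, he, hmin⟩ := J.exists_min_image τ hne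
  have hactive : J ⊆ N.activeOut (𝒮 (τ e)) v := fun k hk =>
    mem_activeOut.2 ⟨mem_outLinks.1 (hJ hk), links_antitone (hmin k hk) (hmem k (hJ hk))⟩
  have hflow : (𝒮 (τ e)).flow e ≤ G.split v J (N.currentInflow lam (𝒮 T) v) e :=
    h.flow_le_split hlam hmono hf₀ (hτT e (hJ he)).le hv hp he hactive
  have hflow₀ : 0 ≤ (𝒮 (τ e)).flow e := flow_nonneg hlam hf₀ _ e
  exact ⟨e, he, (linkMargin_antitoneOn e hflow₀ (hflow₀.trans hflow) hflow).trans
    (hfail e (hJ he) _ (hτT e (hJ he)) (hmem e (hJ he)) (hnotMem e (hJ he)))⟩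

theorem IsTree.linkMargin_flow_le_sum_downstream (h : N.IsTree) (hlam : 0 ≤ lam)
    (hG : G.IsSequentiallyOptimal h.acyclic) (hmono : G.FlowMonotone)
    (hf₀ : N.IsInitialFlow G lam f₀) {d : E → ℝ} (hd : ∀ e, 0 ≤ d e)
    (hres : ∀ t e, N.cap e - d e ≤ (𝒮 t).resCap e) (hp : N.PathActive (𝒮 t) (N.tail e))
    (he : e ∈ (𝒮 t).links) (he' : e ∉ (𝒮 (t + 1)).links) :
    linkMargin h.acyclic e ((𝒮 t).flow e) ≤ ∑ k ∈ N.downstream e, d k := by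
  induction hw : N.head e using h.acyclic.wf.induction generalizing e t with
  | _ w ih =>
    subst hw
    by_cases hcap : (𝒮 t).flow e < (𝒮 t).resCap e
    · obtain ⟨hdest, hnodes⟩ : N.head e ≠ N.dest ∧ N.head e ∉ (𝒮 t).nodes := by
        simpa [mem_links_succ, he, hcap] using he'
      have hhead : N.PathActive (𝒮 t) (N.head e) := hp.head he
      have hnode : nodeMargin h.acyclic (N.head e) (N.currentInflow lam (𝒮 t) (N.head e)) ≤
          ∑ k ∈ N.outLinks (N.head e), ∑ l ∈ N.downstream k, d l :=
        h.nodeMargin_le_sum_outLinks hlam hG hmono hf₀ hdest hhead hnodes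
          (fun k => Finset.sum_nonneg fun l _ => hd l) fun k hk r hr hkr hkr' =>
            have htail : N.tail k = N.head e := mem_outLinks.1 hk
            ih _ ⟨k, htail, rfl⟩ (htail ▸ hhead.mono (links_antitone hr.le)) hkr hkr' rfl
      rw [h.currentInflow_head hdest he] at hnode
      rw [linkMargin, if_neg hdest]
      exact (min_le_right _ _).trans (hnode.trans (h.sum_sum_downstream_le hd fun k hk =>
        downstream_subset_downstream (mem_outLinks.1 hk).symm))
    · calc linkMargin h.acyclic e ((𝒮 t).flow e) ≤ N.cap e - (𝒮 t).flow e :=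
            linkMargin_le_cap_sub e _
        _ ≤ d e := by linarith [hres t e]
        _ ≤ ∑ k ∈ N.downstream e, d k :=
            Finset.single_le_sum (fun k _ => hd k) (self_mem_downstream e)

theorem resCap_eq (t : ℕ) (e : E) :
    (𝒮 t).resCap e = N.cap e - ∑ r ∈ Finset.range t, δ (r + 1) e := by
  induction t with
  | zero => simp [trajectory, initState]
  | succ t ih =>
    rw [Finset.sum_range_succ, ← sub_sub, ← ih]
    rfl

theorem IsDisturbance.cap_sub_tsum_le_resCap (hδ : N.IsDisturbance δ) (t : ℕ) (e : E) :
    N.cap e - ∑' r, δ (r + 1) e ≤ (𝒮 t).resCap e := by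
  rw [resCap_eq]
  exact sub_le_sub_left
    ((hδ.summable e).sum_le_tsum _ fun r _ => hδ.nonneg _ r.succ_pos e) _

theorem IsTree.origin_mem_nodes (h : N.IsTree) (hlam : 0 ≤ lam)
    (hG : G.IsSequentiallyOptimal h.acyclic) (hmono : G.FlowMonotone)
    (hf₀ : N.IsInitialFlow G lam f₀) (hδ : N.IsDisturbance δ)
    (hsmall : magnitude δ < upperMargin h.acyclic lam) (T : ℕ) : N.origin ∈ (𝒮 T).nodes := by
  by_contra hT
  have hd (e : E) : 0 ≤ ∑' r, δ (r + 1) e := tsum_nonneg fun r => hδ.nonneg _ r.succ_pos e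
  have hle : upperMargin h.acyclic lam ≤ magnitude δ := calc
    upperMargin h.acyclic lam
      = nodeMargin h.acyclic N.origin (N.currentInflow lam (𝒮 T) N.origin) := by
        rw [currentInflow_origin, nodeMargin_eq, upperMargin]
    _ ≤ ∑ e ∈ N.outLinks N.origin, ∑ k ∈ N.downstream e, ∑' r, δ (r + 1) k := by
        refine h.nodeMargin_le_sum_outLinks hlam hG hmono hf₀ N.origin_ne_dest
          Relation.ReflTransGen.refl hT (fun e => Finset.sum_nonneg fun k _ => hd k)
          fun e he t _ hmem hnotMem => ?_
        exact h.linkMargin_flow_le_sum_downstream hlam hG hmono hf₀ hd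
          hδ.cap_sub_tsum_le_resCap (mem_outLinks.1 he ▸ Relation.ReflTransGen.refl) hmem hnotMem
    _ ≤ magnitude δ := h.sum_sum_downstream_le hd fun e _ => Finset.subset_univ _
  exact hsmall.not_ge hle

end Failure

section Limit

theorem Acyclic.eventuallyConst_flow (h : N.Acyclic) (e : E) :
    EventuallyConst (fun t => (𝒮 t).flow e) atTop := by
  induction hv : N.tail e using h.wellFounded_step.induction generalizing e with
  | _ v ih =>
    subst hv
    have hlinks : EventuallyConst (fun t => (𝒮 t).links) atTop :=
      eventuallyConst_of_antitone links_antitone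
    have hinflow : EventuallyConst (fun t => N.currentInflow lam (𝒮 t) (N.tail e)) atTop := by
      simp only [currentInflow, ← Finset.sum_ite_mem]
      refine (EventuallyConst.const _).add (eventuallyConst_sum fun k hk => ?_)
      exact hlinks.comp₂ (fun L x => if k ∈ L then x else 0)
        (ih _ ⟨k, rfl, mem_inLinks.1 hk⟩ k rfl)
    have hsucc : EventuallyConst (fun t => (𝒮 (t + 1)).flow e) atTop := by
      refine (hlinks.comp₂ (fun L μ => if e ∈ L then
        G.split (N.tail e) (N.outLinks (N.tail e) ∩ L) μ e else 0) hinflow).congr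
          (Eventually.of_forall fun t => ?_)
      by_cases he : e ∈ (𝒮 t).links
      · simp only [if_pos he, flow_succ he, activeOut]
      · simp only [if_neg he, flow_succ_eq_zero he]
    rwa [EventuallyConst, ← map_add_atTop_eq_nat 1, map_map]

theorem sum_flow_succ (hlam : 0 ≤ lam) (hf₀ : N.IsInitialFlow G lam f₀) (t : ℕ) :
    ∑ e, (𝒮 (t + 1)).flow e = ∑ v ∈ (𝒮 (t + 1)).nodes, N.currentInflow lam (𝒮 t) v := by
  have hmaps : ∀ e ∈ (𝒮 t).links, N.tail e ∈ (𝒮 (t + 1)).nodes := fun e he =>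
    mem_nodes_succ.2 ⟨tail_mem_nodes he, e, mem_activeOut.2 ⟨rfl, he⟩⟩
  have hsplit : ∀ v ∈ (𝒮 (t + 1)).nodes,
      ∑ e ∈ N.activeOut (𝒮 t) v, (𝒮 (t + 1)).flow e = N.currentInflow lam (𝒮 t) v := by
    intro v hv
    rw [← G.sum_eq v (ne_dest_of_mem_nodes hv) _ (activeOut_subset (𝒮 t) v) (mem_nodes_succ.1 hv).2
      _ (currentInflow_nonneg hlam (flow_nonneg hlam hf₀ t) v)]
    refine Finset.sum_congr rfl fun e he => ?_
    obtain ⟨rfl, hlinks⟩ := mem_activeOut.1 he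
    exact flow_succ hlinks
  calc ∑ e, (𝒮 (t + 1)).flow e = ∑ e ∈ (𝒮 t).links, (𝒮 (t + 1)).flow e :=
        (Finset.sum_subset (Finset.subset_univ _) fun e _ he => flow_succ_eq_zero he).symm
    _ = ∑ v ∈ (𝒮 (t + 1)).nodes, ∑ e ∈ (𝒮 t).links with N.tail e = v, (𝒮 (t + 1)).flow e :=
        (Finset.sum_fiberwise_of_maps_to hmaps _).symm
    _ = ∑ v ∈ (𝒮 (t + 1)).nodes, N.currentInflow lam (𝒮 t) v :=
        Finset.sum_congr rfl fun v hv => by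
          rw [← hsplit v hv]
          exact Finset.sum_congr (by ext e; simp [and_comm]) fun _ _ => rfl

theorem sum_inLinks_dest_eq_of_stationary (hlam : 0 ≤ lam) (hf₀ : N.IsInitialFlow G lam f₀)
    (ho : N.origin ∈ (𝒮 (t + 2)).nodes) (hlinks : (𝒮 (t + 1)).links = (𝒮 t).links)
    (hlinks' : (𝒮 (t + 2)).links = (𝒮 (t + 1)).links)
    (hnodes : (𝒮 (t + 2)).nodes = (𝒮 (t + 1)).nodes)
    (hflow : ∀ e, (𝒮 (t + 2)).flow e = (𝒮 (t + 1)).flow e) :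
    ∑ e ∈ N.inLinks N.dest, (𝒮 (t + 1)).flow e = lam := by
  have hout : ∑ v ∈ (𝒮 (t + 2)).nodes, N.currentInflow lam (𝒮 (t + 1)) v =
      ∑ e, (𝒮 (t + 1)).flow e :=
    (sum_flow_succ hlam hf₀ (t + 1)).symm.trans (Finset.sum_congr rfl fun e _ => hflow e)
  have hin := sum_currentInflow_add_sum_inLinks_dest (s := 𝒮 (t + 1)) (lam := lam) ho
    (fun hd => ne_dest_of_mem_nodes hd rfl)
    (fun e he => hnodes ▸ (mem_links_succ.1 (hlinks' ▸ he)).2.2)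
    (fun e he => flow_succ_eq_zero (hlinks ▸ he))
  linarith

theorem Acyclic.isTransferring_of_forall_origin_mem_nodes (h : N.Acyclic) (hlam : 0 ≤ lam)
    (hf₀ : N.IsInitialFlow G lam f₀) (ho : ∀ t, N.origin ∈ (𝒮 t).nodes) :
    N.IsTransferring G lam f₀ δ := by
  have hlinks : ∀ᶠ t in atTop, (𝒮 (t + 1)).links = (𝒮 t).links :=
    eventually_atTop.2 (eventuallyConst_atTop_nat.1 (eventuallyConst_of_antitone links_antitone))
  have hnodes : ∀ᶠ t in atTop, (𝒮 (t + 1)).nodes = (𝒮 t).nodes :=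
    eventually_atTop.2 (eventuallyConst_atTop_nat.1 (eventuallyConst_of_antitone nodes_antitone))
  have hflow : ∀ᶠ t in atTop, ∀ e, (𝒮 (t + 1)).flow e = (𝒮 t).flow e := eventually_all.2 fun e =>
    eventually_atTop.2 (eventuallyConst_atTop_nat.1 (h.eventuallyConst_flow e))
  have hsucc := tendsto_add_atTop_nat 1
  refine (tendsto_add_atTop_iff_nat 1).1 (tendsto_const_nhds.congr' ?_)
  filter_upwards [hlinks, hsucc.eventually hlinks, hsucc.eventually hnodes,
    hsucc.eventually hflow] with t hlinks hlinks' hnodes hflow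
  exact (sum_inLinks_dest_eq_of_stationary hlam hf₀ (ho _) hlinks hlinks' hnodes hflow).symm

end Limit

end Trajectory

end CascadingFailure.Network

theorem theorem2_general {V E : Type*} [Fintype V] [Fintype E] [DecidableEq V] [DecidableEq E]
    (N : CascadingFailure.Network V E)
    (htree : N.IsTree)
    (lam : ℝ) (hlam : 0 ≤ lam)
    (G : N.RoutingPolicy) (hG : G.IsSequentiallyOptimal htree.acyclic) (hmono : G.FlowMonotone)
    (f₀ : E → ℝ) (hf₀ : N.IsInitialFlow G lam f₀)
    (δ : ℕ → E → ℝ) (hδ : N.IsDisturbance δ)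
    (hsmall : CascadingFailure.magnitude δ <
      CascadingFailure.Network.upperMargin htree.acyclic lam) :
    N.IsTransferring G lam f₀ δ :=
  htree.acyclic.isTransferring_of_forall_origin_mem_nodes hlam hf₀
    (htree.origin_mem_nodes hlam hG hmono hf₀ hδ hsmall)

theorem theorem2 {V E : Type*} [Fintype V] [Fintype E] [DecidableEq V] [DecidableEq E]
    (N : CascadingFailure.Network V E)
    (htree : N.IsTree)
    (hdeg : ∀ v, v ≠ N.dest → (N.outLinks v).card ≤ 3)
    (lam : ℝ) (hlam : 0 < lam)
    (G : N.RoutingPolicy) (hG : G.IsBPA htree.acyclic) (hmono : G.FlowMonotone)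
    (f₀ : E → ℝ) (hf₀ : N.IsInitialFlow G lam f₀)
    (δ : ℕ → E → ℝ) (hδ : N.IsDisturbance δ)
    (hsmall : CascadingFailure.magnitude δ <
      CascadingFailure.Network.upperMargin htree.acyclic lam) :
    N.IsTransferring G lam f₀ δ :=
  theorem2_general N htree lam hlam.le G (hG.isSequentiallyOptimal hdeg) hmono f₀ hf₀ δ hδ hsmall
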